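/- Let $\alpha>0$, $\kappa>0$ and $0<\epsilon<1$ be fixed. For $n\ge 1$ equip the complete graph $K_n$ with unit conductances and constant killing factor $\kappa$, so that the transition matrix is $P_{x,y}=\frac{1}{n-1+\kappa}$ for $x\ne y$ and $P_{x,x}=0$. A discrete oriented loop is a sequence of vertices $(x_1,\dots,x_k)$, $k\ge 2$, with $x_i\neq x_{i+1}$ for $1\le i<k$ and $x_k\ne x_1$, considered up to cyclic rotation; $k$ is its length. Let $\nu_n$ be the measure on loops giving to each loop the mass $P_{x_1,x_2}P_{x_2,x_3}\cdots P_{x_k,x_1}$ divided by its multiplicity (the largest $m$ such that the loop is the $m$-fold repetition of some loop), and let $\mathcal{DL}_\alpha$ be a Poisson process of loops on $K_n$ with intensity $\alpha\nu_n$. Let $\mathcal C_\alpha$ be the partition of the vertex set into the connected components (clusters, isolated vertices included) of the graph formed by the edges traversed by at least one loop of $\mathcal{DL}_\alpha$. Then, as $n\to\infty$, $$\mathbb P\big(\mathcal C_\alpha \text{ has a cluster with more than } n^{1-\epsilon}\text{ vertices}\big)\longrightarrow 1 .$$ Moreover, as $n\to\infty$, the probability that $\mathcal{DL}_\alpha$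 contains a loop of length larger than $n^{1-\epsilon}$ which visits more than $(1-\epsilon)n^{1-\epsilon}$ distinct vertices converges to $1$. -/

import Mathlib

open MeasureTheory ProbabilityTheory Filter Topology
open scoped NNReal ENNReal

noncomputable section

/-- A graph on the vertex set `V` without self-loops, equipped with symmetric conductances `C x y`
(positive exactly on the edges) and a nonnegative killing function. -/
structure LoopNetwork (V : Type*) where
  /-- the conductances -/
  cond : V → V → ℝ≥0
  cond_symm : ∀ x y, cond x y = cond y x
  cond_self : ∀ x, cond x x = 0
  /-- the killing function -/
  kill : V → ℝ≥0

/-- The underlying graph: the edges are the pairs with a nonzero conductance. -/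
def LoopNetwork.graph {V : Type*} (N : LoopNetwork V) : SimpleGraph V where
  Adj x y := N.cond x y ≠ 0
  symm := ⟨fun x y h => by rwa [N.cond_symm y x]⟩
  loopless := ⟨fun x h => h (N.cond_self x)⟩

/-- `λ_x = ∑_y C_{x,y} + κ_x`. -/
def LoopNetwork.rate {V : Type*} [Fintype V] (N : LoopNetwork V) (x : V) : ℝ≥0 :=
  ∑ y, N.cond x y + N.kill x

/-- The (sub-Markovian) transition matrix `P_{x,y} = C_{x,y} / λ_x`. -/
def LoopNetwork.trans {V : Type*} [Fintype V] (N : LoopNetwork V) (x y : V) : ℝ≥0 :=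
  N.cond x y / N.rate x

/-- Discrete oriented loops: based loops `(x₁, …, x_k)`, `k ≥ 2`, with `x_i` adjacent to `x_{i+1}`
and `x_k` adjacent to `x₁`, up to cyclic rotation. -/
def DiscreteLoop {V : Type*} (G : SimpleGraph V) : Type _ :=
  {c : Cycle V // 2 ≤ c.length ∧ c.Chain G.Adj}

/-- The product `f x₁ x₂ * f x₂ x₃ * ⋯ * f x_k x₁` along a based loop `[x₁, …, x_k]`. -/
def listEdgeProd {V : Type*} (f : V → V → ℝ≥0) (l : List V) : ℝ≥0 :=
  (List.zipWith f l (l.rotate 1)).prod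

theorem listEdgeProd_rotate {V : Type*} (f : V → V → ℝ≥0) (l : List V) (n : ℕ) :
    listEdgeProd f (l.rotate n) = listEdgeProd f l := by
  unfold listEdgeProd
  rw [List.rotate_rotate, Nat.add_comm n 1, ← List.rotate_rotate,
    ← List.zipWith_rotate_distrib f l (l.rotate 1) n (List.length_rotate l 1).symm]
  exact (List.rotate_perm _ _).prod_eq

/-- The product of the values of `f` over the edges of a cycle. -/
def cycleEdgeProd {V : Type*} (f : V → V → ℝ≥0) (c : Cycle V) : ℝ≥0 :=
  Quotient.liftOn c (listEdgeProd f) (by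
    rintro a b ⟨n, rfl⟩
    exact (listEdgeProd_rotate f a n).symm)

/-- The multiplicity of a loop: the largest `m` such that the loop is the `m`-fold repetition of
another one. -/
def cycleMultiplicity {V : Type*} (c : Cycle V) : ℕ :=
  sSup {m : ℕ | ∃ b : List V, c = (((List.replicate m b).flatten : List V) : Cycle V)}

/-- The loop measure `ν`, given by its mass at each loop: the product of the transition
probabilities of the edges of the loop divided by the multiplicity of the loop. -/
def LoopNetwork.loopMass {V : Type*} [Fintype V] (N : LoopNetwork V)
    (l : DiscreteLoop N.graph) : ℝ≥0 :=
  cycleEdgeProd N.trans l.1 / (cycleMultiplicity l.1 : ℝ≥0)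

/-- A loop configuration is a multiset of loops, encoded by the number of copies of each loop. -/
abbrev LoopConfig {V : Type*} (G : SimpleGraph V) : Type _ := DiscreteLoop G → ℕ

/-- The law of the Poisson process `𝓓𝓛_α` of loops with intensity `α ν`. As the set of loops is
countable and discrete, this means that the numbers of copies of the loops `l` are independent
Poisson variables with parameters `α ν(l)`. -/
def LoopNetwork.loopEnsemble {V : Type*} [Fintype V] (N : LoopNetwork V) (α : ℝ≥0) :
    Measure (LoopConfig N.graph) :=
  Measure.infinitePi fun l => poissonMeasure (α * N.loopMass l)

/-- The cycle `c` traverses the oriented edge from `x` to `y`. -/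
def CycleTraverses {V : Type*} (c : Cycle V) (x y : V) : Prop :=
  ∃ t : List V, c = ((x :: y :: t : List V) : Cycle V)

/-- The graph of the edges occupied by a loop configuration, that is, traversed (in one direction
or the other) by at least one of its loops. -/
def occupiedGraph {V : Type*} {G : SimpleGraph V} (ω : LoopConfig G) : SimpleGraph V :=
  SimpleGraph.fromRel fun x y => ∃ l : DiscreteLoop G, 0 < ω l ∧ CycleTraverses l.1 x y

/-- The clusters of a loop configuration: the blocks of the partition of the vertex set into the
connected components of the graph of occupied edges (isolated vertices included). -/
def loopClusters {V : Type*} {G : SimpleGraph V} (ω : LoopConfig G) : Set (Set V) :=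
  {B | ∃ K : (occupiedGraph ω).ConnectedComponent, B = K.supp}

/-- The set of vertices visited by a loop. -/
def DiscreteLoop.vertices {V : Type*} {G : SimpleGraph V} (l : DiscreteLoop G) : Set V :=
  {x | x ∈ l.1}

/-- The complete graph `K_n` with unit conductances and constant killing factor `κ`. -/
def completeNetwork (n : ℕ) (κ : ℝ≥0) : LoopNetwork (Fin n) where
  cond x y := if x = y then 0 else 1
  cond_symm x y := by simp only [eq_comm]
  cond_self x := if_pos rfl
  kill _ := κ

end

/-! Both claims follow from one event: some loop of the ensemble visits more than `n ^ (1 - ε)`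
distinct vertices. Its length is at least that number, and its vertices lie in a single cluster
(`exists_cluster_of_loop`). The number of loops in a finite family is Poisson, so it suffices that
the mass of suitable loops diverges. For `6 * k ≤ n`, at least half of the `n ^ k` vertex sequences
are spread walks (`pow_le_two_mul_card_spreadWalks`). Visiting more than `k / 2` points forces
multiplicity one, a loop has at most `k` base points, and each walk has weight about `n ^ (-k)`.
Hence length `k` contributes at least `exp (-κ) / (2 * k)` (`le_sum_spreadCycles`). Summing over `k`
from about `2 * n ^ (1 - ε)` to `n / 6` gives at least a constant times `ε * log n - log 24`, which
tends to infinity. -/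

/-! ### Counting spread walks -/

/-- The closed walks `x : Fin k → Fin n` without immediate repetition (also from the last to the
first position) which visit more than `k / 2` distinct points. -/
def spreadWalks (k n : ℕ) : Finset (Fin k → Fin n) :=
  Finset.univ.filter fun x => (∀ i j : Fin k, (j : ℕ) = (i + 1) % k → x i ≠ x j) ∧
    k < 2 * (Finset.univ.image x).card

theorem card_filter_apply_eq_le {k n : ℕ} {i j : Fin k} (hij : i ≠ j) :
    (Finset.univ.filter fun x : Fin k → Fin n => x i = x j).card ≤ n ^ (k - 1) := by
  have h : (Finset.univ : Finset ({l : Fin k // l ≠ j} → Fin n)).card = n ^ (k - 1) := by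
    simp [Fintype.card_subtype_compl]
  rw [← h]
  refine Finset.card_le_card_of_injOn (fun x l => x l.1) (fun _ _ => Finset.mem_coe.2 (Finset.mem_univ _)) ?_
  intro x hx y hy hxy
  simp only [Finset.coe_filter, Finset.mem_univ, true_and, Set.mem_ofPred_eq] at hx hy
  have hl : ∀ l, l ≠ j → x l = y l := fun l hl => congrFun hxy ⟨l, hl⟩
  funext l
  by_cases h : l = j
  · subst h
    rw [← hx, ← hy, hl i hij]
  · exact hl l h

/-- Indices where a value first occurs inject into the image; every other index is the first entry
of a colliding pair. -/
theorem le_card_image_add_card_collisions {k n : ℕ} (x : Fin k → Fin n) :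
    k ≤ (Finset.univ.image x).card +
      ((Finset.univ : Finset (Fin k)).offDiag.filter fun p => x p.1 = x p.2).card := by
  classical
  set S := Finset.univ.filter fun i : Fin k => ∀ j < i, x j ≠ x i
  have h1 : S.card ≤ (Finset.univ.image x).card := by
    refine Finset.card_le_card_of_injOn x (fun i _ => by simp) ?_
    intro i hi j hj hij
    simp only [S, Finset.coe_filter, Finset.mem_univ, true_and, Set.mem_ofPred_eq] at hi hj
    rcases lt_trichotomy i j with h | h | h
    · exact absurd hij (hj i h)
    · exact h
    · exact absurd hij.symm (hi j h)
  have h2 : Sᶜ.card ≤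
      ((Finset.univ : Finset (Fin k)).offDiag.filter fun p => x p.1 = x p.2).card := by
    have hsub : Sᶜ ⊆
        ((Finset.univ : Finset (Fin k)).offDiag.filter fun p => x p.1 = x p.2).image Prod.fst := by
      intro i hi
      simp only [S, Finset.mem_compl, Finset.mem_filter, Finset.mem_univ, true_and, not_forall,
        not_not] at hi
      obtain ⟨j, hji, hx⟩ := hi
      exact Finset.mem_image.2 ⟨(i, j), by simp [hx, hji.ne'], rfl⟩
    exact (Finset.card_le_card hsub).trans Finset.card_image_le
  have h3 := Finset.card_add_card_compl S
  rw [Fintype.card_fin] at h3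
  omega

theorem card_filter_not_cyclic_ne_le {k n : ℕ} (hk : 2 ≤ k) :
    (Finset.univ.filter fun x : Fin k → Fin n =>
      ¬ ∀ i j : Fin k, (j : ℕ) = (i + 1) % k → x i ≠ x j).card ≤ k * n ^ (k - 1) := by
  have hsub : (Finset.univ.filter fun x : Fin k → Fin n =>
      ¬ ∀ i j : Fin k, (j : ℕ) = (i + 1) % k → x i ≠ x j) ⊆
      Finset.univ.biUnion fun i : Fin k => Finset.univ.filter fun x : Fin k → Fin n =>
        x i = x ⟨(i + 1) % k, Nat.mod_lt _ (by omega)⟩ := by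
    intro x hx
    simp only [Finset.mem_filter, Finset.mem_univ, true_and, not_forall, not_not] at hx
    obtain ⟨i, j, hij, hx⟩ := hx
    have : j = ⟨(i + 1) % k, Nat.mod_lt _ (by omega)⟩ := Fin.ext hij
    simp only [Finset.mem_biUnion, Finset.mem_filter, Finset.mem_univ, true_and]
    exact ⟨i, this ▸ hx⟩
  refine (Finset.card_le_card hsub).trans ?_
  refine (Finset.card_biUnion_le_card_mul _ _ (n ^ (k - 1)) fun i _ => ?_).trans (by simp)
  apply card_filter_apply_eq_le
  intro h
  have h' : (i : ℕ) = (i + 1) % k := congrArg Fin.val h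
  have hi := i.2
  rcases (by omega : (i : ℕ) + 1 < k ∨ (i : ℕ) + 1 = k) with h1 | h1
  · rw [Nat.mod_eq_of_lt h1] at h'; omega
  · rw [h1, Nat.mod_self] at h'; omega

/-- First-moment bound: a walk with few points has at least `k / 2` ordered collisions, while all
walks together have at most `k ^ 2 * n ^ (k - 1)`. -/
theorem card_filter_few_points_le {k n : ℕ} (hk : 0 < k) :
    (Finset.univ.filter fun x : Fin k → Fin n =>
      2 * (Finset.univ.image x).card ≤ k).card ≤ 2 * k * n ^ (k - 1) := by
  classical
  set B := Finset.univ.filter fun x : Fin k → Fin n => 2 * (Finset.univ.image x).card ≤ k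
  have h1 : B.card * k ≤ ∑ x ∈ B,
      2 * ((Finset.univ : Finset (Fin k)).offDiag.filter fun p => x p.1 = x p.2).card := by
    rw [← smul_eq_mul]
    refine Finset.card_nsmul_le_sum _ _ _ fun x hx => ?_
    have := le_card_image_add_card_collisions x
    simp only [B, Finset.mem_filter, Finset.mem_univ, true_and] at hx
    omega
  have h2 : ∑ x ∈ B,
      2 * ((Finset.univ : Finset (Fin k)).offDiag.filter fun p => x p.1 = x p.2).card ≤
      ∑ x : Fin k → Fin n,
      2 * ((Finset.univ : Finset (Fin k)).offDiag.filter fun p => x p.1 = x p.2).card :=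
    Finset.sum_le_sum_of_subset (Finset.subset_univ _)
  have h3 : ∑ x : Fin k → Fin n,
      ((Finset.univ : Finset (Fin k)).offDiag.filter fun p => x p.1 = x p.2).card ≤
      (k * k) * n ^ (k - 1) := by
    simp_rw [Finset.card_filter]
    rw [Finset.sum_comm]
    simp_rw [← Finset.card_filter]
    refine (Finset.sum_le_card_nsmul _ _ (n ^ (k - 1)) fun p hp => ?_).trans ?_
    · exact card_filter_apply_eq_le (Finset.mem_offDiag.1 hp).2.2
    · rw [smul_eq_mul]
      refine Nat.mul_le_mul_right _ ?_
      rw [Finset.offDiag_card, Finset.card_univ, Fintype.card_fin]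
      omega
  rw [← Finset.mul_sum, ← Finset.mul_sum] at h2
  rw [← Finset.mul_sum] at h1
  refine Nat.le_of_mul_le_mul_right (c := k) ?_ hk
  nlinarith

theorem pow_le_two_mul_card_spreadWalks {k n : ℕ} (hk : 2 ≤ k) (hkn : 6 * k ≤ n) :
    n ^ k ≤ 2 * (spreadWalks k n).card := by
  classical
  have h1 := card_filter_not_cyclic_ne_le (n := n) hk
  have h2 := card_filter_few_points_le (n := n) (k := k) (by omega)
  have h3 : (spreadWalks k n)ᶜ ⊆ (Finset.univ.filter fun x : Fin k → Fin n =>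
      ¬ ∀ i j : Fin k, (j : ℕ) = (i + 1) % k → x i ≠ x j) ∪
      (Finset.univ.filter fun x : Fin k → Fin n => 2 * (Finset.univ.image x).card ≤ k) := by
    intro x hx
    simp only [spreadWalks, Finset.mem_compl, Finset.mem_filter, Finset.mem_univ, true_and,
      not_and_or, not_lt] at hx
    simpa only [Finset.mem_union, Finset.mem_filter, Finset.mem_univ, true_and] using hx
  have h4 := (Finset.card_le_card h3).trans (Finset.card_union_le _ _)
  have h5 := Finset.card_add_card_compl (spreadWalks k n)
  rw [Fintype.card_fun, Fintype.card_fin, Fintype.card_fin] at h5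
  -- The two kinds of bad walks number at most `(k + 2 * k) * n ^ (k - 1)`; the 6 makes this at most
  -- half of `n ^ k`.
  have h6 : 6 * k * n ^ (k - 1) ≤ n ^ k := by
    calc 6 * k * n ^ (k - 1) ≤ n * n ^ (k - 1) := Nat.mul_le_mul_right _ hkn
      _ = n ^ k := by rw [← pow_succ']; congr 1; omega
  linarith

/-! ### Harmonic sums and Poisson void probabilities -/

theorem log_sub_log_le_sum_Ioc (a b : ℕ) :
    Real.log (b + 1) - Real.log (a + 1) ≤ ∑ k ∈ Finset.Ioc a b, (1 / k : ℝ) := by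
  induction b with
  | zero =>
    have : 0 ≤ Real.log ((a : ℝ) + 1) := Real.log_nonneg (by linarith [(Nat.cast_nonneg a : (0:ℝ) ≤ a)])
    simpa using this
  | succ b ih =>
    rcases le_or_gt a b with h | h
    · rw [Finset.sum_Ioc_succ_top h]
      have hb : (0 : ℝ) < b + 1 := by positivity
      have h1 : Real.log ((b + 1 + 1) / (b + 1)) ≤ (b + 1 + 1) / (b + 1) - 1 :=
        Real.log_le_sub_one_of_pos (by positivity)
      rw [Real.log_div (by positivity) hb.ne'] at h1
      have h2 : ((b : ℝ) + 1 + 1) / (b + 1) - 1 = 1 / (b + 1) := by field_simp; ring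
      push_cast
      linarith
    · rw [Finset.Ioc_eq_empty_of_le (by omega), Finset.sum_empty, sub_nonpos]
      exact Real.log_le_log (by positivity) (by exact_mod_cast by omega)

theorem poisson_exists_pos_ge {ι : Type*} (r : ι → ℝ≥0) (A : Finset ι) :
    ENNReal.ofReal (1 - Real.exp (-∑ i ∈ A, (r i : ℝ))) ≤
      Measure.infinitePi (fun i => poissonMeasure (r i)) {ω | ∃ i ∈ A, 0 < ω i} := by
  have h1 : Measure.infinitePi (fun i => poissonMeasure (r i))
      (Set.pi A fun _ => ({0} : Set ℕ)) = ENNReal.ofReal (Real.exp (-∑ i ∈ A, (r i : ℝ))) := by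
    rw [Measure.infinitePi_pi _ (fun _ _ => measurableSet_singleton _)]
    simp_rw [poissonMeasure_singleton]
    rw [← ENNReal.ofReal_prod_of_nonneg (fun _ _ => by positivity), ← Finset.sum_neg_distrib,
      Real.exp_sum]
    simp
  have h2 : {ω : ι → ℕ | ∃ i ∈ A, 0 < ω i} = (Set.pi A fun _ => ({0} : Set ℕ))ᶜ := by
    ext ω
    simp [Set.mem_pi, Nat.pos_iff_ne_zero]
  rw [h2, prob_compl_eq_one_sub (MeasurableSet.pi A.countable_toSet
    fun _ _ => measurableSet_singleton _), h1, ENNReal.ofReal_sub _ (Real.exp_nonneg _),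
    ENNReal.ofReal_one]

/-! ### Cycles represented by lists -/

theorem cycle_chain_of_getElem {V : Type*} {r : V → V → Prop} {L : List V}
    (h : ∀ i (hi : i < L.length), r L[i] (L[(i + 1) % L.length]'(Nat.mod_lt _ (by omega)))) :
    Cycle.Chain r (L : Cycle V) := by
  cases L with
  | nil => exact Cycle.Chain.nil r
  | cons a t =>
    rw [Cycle.chain_coe_cons, ← List.cons_append, List.isChain_iff_getElem]
    intro i hi
    have hi' : i < (a :: t).length := by simpa using hi
    have h1 := h i hi'
    rw [List.getElem_append_left hi']
    rcases (by omega : i + 1 < (a :: t).length ∨ i + 1 = (a :: t).length) with h2 | h2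
    · rw [List.getElem_append_left h2]
      simpa only [Nat.mod_eq_of_lt h2] using h1
    · rw [List.getElem_append_right h2.ge]
      simpa [h2, Nat.mod_self] using h1

theorem listEdgeProd_eq_pow {V : Type*} {f : V → V → ℝ≥0} {p : ℝ≥0} {L : List V}
    (h : ∀ i (hi : i < L.length),
      f L[i] (L[(i + 1) % L.length]'(Nat.mod_lt _ (by omega))) = p) :
    listEdgeProd f L = p ^ L.length := by
  unfold listEdgeProd
  rw [List.prod_eq_pow_card _ p]
  · simp
  · intro y hy
    obtain ⟨i, hi, rfl⟩ := List.getElem_of_mem hy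
    rw [List.getElem_zipWith, List.getElem_rotate]
    exact h i _

/-- An `m`-fold repetition of `b` visits at most `b.length` points, which for `m ≥ 2` is at most
half the length. -/
theorem cycleMultiplicity_eq_one {V : Type*} [DecidableEq V] {L : List V}
    (h : L.length < 2 * L.toFinset.card) : cycleMultiplicity (L : Cycle V) = 1 := by
  have hub : ∀ m ∈ {m : ℕ | ∃ b : List V,
      (L : Cycle V) = (((List.replicate m b).flatten : List V) : Cycle V)}, m ≤ 1 := by
    rintro m ⟨b, hb⟩
    have hrot : L ~r (List.replicate m b).flatten := Cycle.coe_eq_coe.1 hb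
    have hlen : L.length = m * b.length := by simp [hrot.perm.length_eq]
    have hsub : L.toFinset ⊆ b.toFinset := by
      intro v hv
      rw [List.mem_toFinset, hrot.mem_iff, List.mem_flatten] at hv
      obtain ⟨l, hl, hv⟩ := hv
      rw [List.eq_of_mem_replicate hl] at hv
      exact List.mem_toFinset.2 hv
    have hcard := (Finset.card_le_card hsub).trans b.toFinset_card_le
    by_contra! hm
    have := Nat.mul_le_mul_right b.length hm
    omega
  refine le_antisymm (csSup_le' hub) (le_csSup ⟨1, hub⟩ ⟨L, by simp⟩)

theorem card_filter_ofFn_eq_le {V : Type*} [DecidableEq V] {k : ℕ}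
    (hk : 0 < k) (s : Finset (Fin k → V)) (x₀ : Fin k → V) :
    (s.filter fun x => (List.ofFn x : Cycle V) = (List.ofFn x₀ : Cycle V)).card ≤ k := by
  have h : (((s.filter fun x => (List.ofFn x : Cycle V) = (List.ofFn x₀ : Cycle V)).image
      List.ofFn)).card ≤ k := by
    refine (Finset.card_le_card (t := (List.ofFn x₀).cyclicPermutations.toFinset) ?_).trans ?_
    · intro L hL
      obtain ⟨x, hx, rfl⟩ := Finset.mem_image.1 hL
      rw [List.mem_toFinset, List.mem_cyclicPermutations_iff]
      exact Cycle.coe_eq_coe.1 (Finset.mem_filter.1 hx).2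
    · refine (List.toFinset_card_le _).trans (le_of_eq ?_)
      rw [List.length_cyclicPermutations_of_ne_nil _ (by
        rw [Ne, List.ofFn_eq_nil_iff]; omega), List.length_ofFn]
  rwa [Finset.card_image_of_injective _ List.ofFn_injective] at h

/-! ### Loops and clusters -/

theorem reachable_occupiedGraph {V : Type*} {G : SimpleGraph V} {ω : LoopConfig G}
    {l : DiscreteLoop G} (hl : 0 < ω l) {L : List V} (hL : l.1 = (L : Cycle V))
    (h0 : 0 < L.length) (i : ℕ) (hi : i < L.length) :
    (occupiedGraph ω).Reachable L[0] L[i] := by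
  induction i with
  | zero => exact SimpleGraph.Reachable.refl _
  | succ i ih =>
    refine (ih (by omega)).trans ?_
    by_cases hne : L[i] = L[i + 1]
    · rw [hne]
    · refine SimpleGraph.Adj.reachable ?_
      rw [occupiedGraph, SimpleGraph.fromRel_adj]
      -- Rotating by `i` brings the edge from `L[i]` to `L[i + 1]` to the front.
      refine ⟨hne, Or.inl ⟨l, hl, L.drop (i + 2) ++ L.take i, ?_⟩⟩
      rw [hL, Cycle.coe_eq_coe]
      refine ⟨i, ?_⟩
      rw [List.rotate_eq_drop_append_take (by omega), List.drop_eq_getElem_cons (by omega),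
        List.drop_eq_getElem_cons (by omega)]
      rfl

theorem exists_cluster_of_loop {V : Type*} [Finite V] {G : SimpleGraph V} {ω : LoopConfig G}
    {l : DiscreteLoop G} (hl : 0 < ω l) :
    ∃ B ∈ loopClusters ω, l.vertices.ncard ≤ B.ncard := by
  obtain ⟨L, hL⟩ : ∃ L : List V, l.1 = (L : Cycle V) := ⟨l.1.out, (Quotient.out_eq _).symm⟩
  have h0 : 0 < L.length := by
    have := l.2.1
    rw [hL, Cycle.length_coe] at this
    omega
  refine ⟨_, ⟨(occupiedGraph ω).connectedComponentMk L[0], rfl⟩,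
    Set.ncard_le_ncard (fun v hv => ?_) (Set.toFinite _)⟩
  have hv' : v ∈ L := by
    have : v ∈ l.1 := hv
    rwa [hL, Cycle.mem_coe_iff] at this
  obtain ⟨i, hi, rfl⟩ := List.getElem_of_mem hv'
  rw [SimpleGraph.ConnectedComponent.mem_supp_iff, SimpleGraph.ConnectedComponent.eq]
  exact (reachable_occupiedGraph hl hL h0 i hi).symm

/-! ### Mass of the spread loops on the complete graph -/

theorem completeNetwork_trans {n : ℕ} {κ : ℝ≥0} {x y : Fin n} (h : x ≠ y) :
    (completeNetwork n κ).trans x y = 1 / ((n - 1 : ℕ) + κ) := by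
  unfold LoopNetwork.trans LoopNetwork.rate
  have : ∑ z : Fin n, (if x = z then (0 : ℝ≥0) else 1) = (n - 1 : ℕ) := by
    rw [Finset.sum_ite, Finset.sum_const_zero, zero_add, Finset.sum_const, nsmul_one,
      Finset.filter_not, Finset.card_sdiff]
    simp [Finset.filter_eq]
  simp [completeNetwork, h, this]

theorem completeNetwork_adj {n : ℕ} {κ : ℝ≥0} {x y : Fin n} (h : x ≠ y) :
    (completeNetwork n κ).graph.Adj x y := by
  simp [LoopNetwork.graph, completeNetwork, h]

theorem getElem_ofFn_ne_of_mem_spreadWalks {k n : ℕ} {x : Fin k → Fin n}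
    (hx : x ∈ spreadWalks k n) (i : ℕ) (hi : i < (List.ofFn x).length) :
    (List.ofFn x)[i] ≠
      ((List.ofFn x)[(i + 1) % (List.ofFn x).length]'(Nat.mod_lt _ (by omega))) := by
  rw [List.getElem_ofFn, List.getElem_ofFn]
  refine (Finset.mem_filter.1 hx).2.1 _ _ ?_
  simp

theorem toFinset_ofFn {V : Type*} [DecidableEq V] {k : ℕ} (x : Fin k → V) :
    (List.ofFn x).toFinset = Finset.univ.image x := by
  ext v
  simp [List.mem_ofFn]

theorem cycle_mass_of_mem_spreadWalks {k n : ℕ} {κ : ℝ≥0} {x : Fin k → Fin n}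
    (hx : x ∈ spreadWalks k n) :
    cycleEdgeProd (completeNetwork n κ).trans (List.ofFn x : Cycle (Fin n)) /
      (cycleMultiplicity (List.ofFn x : Cycle (Fin n)) : ℝ≥0) =
      (1 / ((n - 1 : ℕ) + κ)) ^ k := by
  rw [cycleMultiplicity_eq_one, Nat.cast_one, div_one]
  · have := listEdgeProd_eq_pow (f := (completeNetwork n κ).trans) fun i hi =>
      completeNetwork_trans (κ := κ) (getElem_ofFn_ne_of_mem_spreadWalks hx i hi)
    rw [List.length_ofFn] at this
    exact this
  · rw [toFinset_ofFn, List.length_ofFn]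
    exact (Finset.mem_filter.1 hx).2.2

/-- The cycles of length in `(a, b]` represented by a spread walk. -/
def spreadCycles (n a b : ℕ) : Finset (Cycle (Fin n)) :=
  (Finset.Ioc a b).biUnion fun k =>
    (spreadWalks k n).image fun x => (List.ofFn x : Cycle (Fin n))

/-- Since `n - 1 + κ ≤ n * (1 + κ / n)`, the loss per step is at most `1 + κ / n`, and `k ≤ n` steps
lose at most `exp κ`. -/
theorem exp_neg_div_le {n k : ℕ} (hn : 2 ≤ n) (hkn : k ≤ n) (κ : ℝ≥0) :
    Real.exp (-κ) ≤ (n : ℝ) ^ k * (((1 / ((n - 1 : ℕ) + κ)) ^ k : ℝ≥0) : ℝ) := by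
  have hn' : (0 : ℝ) < n := by exact_mod_cast (by omega : 0 < n)
  have h1 : ((n - 1 : ℕ) : ℝ) = n - 1 := by rw [Nat.cast_sub (by omega)]; simp
  have hκ : (0 : ℝ) ≤ κ := κ.coe_nonneg
  have h2 : (1 + κ / n : ℝ) ^ k ≤ Real.exp κ := by
    calc (1 + κ / n : ℝ) ^ k ≤ Real.exp (κ / n) ^ k := by
          gcongr
          rw [add_comm]
          exact Real.add_one_le_exp _
      _ = Real.exp (k * (κ / n)) := (Real.exp_nat_mul _ _).symm
      _ ≤ Real.exp κ := by
          refine Real.exp_le_exp.2 ?_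
          rw [mul_div_left_comm]
          refine mul_le_of_le_one_right hκ ((div_le_one hn').2 (by exact_mod_cast hkn))
  have hn2 : (2 : ℝ) ≤ n := by exact_mod_cast hn
  have h3 : (1 + κ / n : ℝ)⁻¹ ≤ n * (1 / ((n : ℝ) - 1 + κ)) := by
    rw [mul_one_div, inv_le_comm₀ (by positivity) (div_pos hn' (by linarith)), inv_div,
      div_le_iff₀ hn', add_mul, div_mul_cancel₀ _ hn'.ne']
    linarith
  rw [NNReal.coe_pow, NNReal.coe_div, NNReal.coe_add, NNReal.coe_natCast, NNReal.coe_one, h1,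
    ← mul_pow, Real.exp_neg]
  refine (inv_anti₀ (by positivity) h2).trans ?_
  rw [← inv_pow]
  gcongr

theorem le_sum_spreadCycles {n a b : ℕ} (ha : 1 ≤ a) (hb : 6 * b ≤ n) (κ : ℝ≥0) :
    Real.exp (-κ) / 2 * (Real.log (b + 1) - Real.log (a + 1)) ≤
      ∑ c ∈ spreadCycles n a b, ((cycleEdgeProd (completeNetwork n κ).trans c /
        (cycleMultiplicity c : ℝ≥0) : ℝ≥0) : ℝ) := by
  rw [spreadCycles, Finset.sum_biUnion]
  · refine (mul_le_mul_of_nonneg_left (log_sub_log_le_sum_Ioc a b) (by positivity)).trans ?_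
    rw [Finset.mul_sum]
    refine Finset.sum_le_sum fun k hk => ?_
    rw [Finset.mem_Ioc] at hk
    have hconst : ∀ c ∈ (spreadWalks k n).image fun x => (List.ofFn x : Cycle (Fin n)),
        ((cycleEdgeProd (completeNetwork n κ).trans c / (cycleMultiplicity c : ℝ≥0) : ℝ≥0) : ℝ)
          = (((1 / ((n - 1 : ℕ) + κ)) ^ k : ℝ≥0) : ℝ) := by
      intro c hc
      obtain ⟨x, hx, rfl⟩ := Finset.mem_image.1 hc
      rw [cycle_mass_of_mem_spreadWalks hx]
    rw [Finset.sum_congr rfl hconst, Finset.sum_const, nsmul_eq_mul]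
    have h1 : (spreadWalks k n).card ≤ k *
        ((spreadWalks k n).image fun x => (List.ofFn x : Cycle (Fin n))).card := by
      refine Finset.card_le_mul_card_image _ _ fun c hc => ?_
      obtain ⟨x, hx, rfl⟩ := Finset.mem_image.1 hc
      exact card_filter_ofFn_eq_le (by omega) _ x
    have h2 := pow_le_two_mul_card_spreadWalks (k := k) (n := n) (by omega) (by omega)
    have h3 : (n : ℝ) ^ k ≤ 2 * (k *
        (((spreadWalks k n).image fun x => (List.ofFn x : Cycle (Fin n))).card : ℝ)) := by
      exact_mod_cast h2.trans (by omega)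
    have h4 := exp_neg_div_le (n := n) (k := k) (by omega) (by omega) κ
    have hk0 : (0 : ℝ) < k := by exact_mod_cast (by omega : 0 < k)
    have h5 := h4.trans (mul_le_mul_of_nonneg_right h3 (NNReal.coe_nonneg _))
    rw [div_mul_div_comm, div_le_iff₀ (by positivity)]
    linarith
  · intro k _ k' _ hkk'
    rw [Function.onFun, Finset.disjoint_left]
    intro c hc hc'
    obtain ⟨x, -, rfl⟩ := Finset.mem_image.1 hc
    obtain ⟨y, -, hy⟩ := Finset.mem_image.1 hc'
    have := congrArg Cycle.length hy
    simp only [Cycle.length_coe, List.length_ofFn] at this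
    exact hkk' this.symm

theorem spreadCycles_spec {n a b : ℕ} (ha : 1 ≤ a) (κ : ℝ≥0) {c : Cycle (Fin n)}
    (hc : c ∈ spreadCycles n a b) :
    (2 ≤ c.length ∧ c.Chain (completeNetwork n κ).graph.Adj) ∧
      a < 2 * {v | v ∈ c}.ncard ∧ {v | v ∈ c}.ncard ≤ c.length := by
  obtain ⟨k, hk, hc⟩ := Finset.mem_biUnion.1 hc
  obtain ⟨x, hx, rfl⟩ := Finset.mem_image.1 hc
  rw [Finset.mem_Ioc] at hk
  have hset : {v | v ∈ (List.ofFn x : Cycle (Fin n))} = ((List.ofFn x).toFinset : Set (Fin n)) := by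
    ext v
    simp
  rw [hset, Set.ncard_coe_finset, Cycle.length_coe]
  refine ⟨⟨by rw [List.length_ofFn]; omega, cycle_chain_of_getElem fun i hi =>
    completeNetwork_adj (getElem_ofFn_ne_of_mem_spreadWalks hx i hi)⟩, ?_,
    List.toFinset_card_le _⟩
  rw [toFinset_ofFn]
  exact hk.1.trans (Finset.mem_filter.1 hx).2.2

/-! ### Existence of a large loop with high probability -/

/-- The loop ensemble on the complete graph contains, with probability at least
`1 - ((a + 1) / (b + 1)) ^ (α e^{-κ} / 2)`, a loop visiting more than `a / 2` vertices. -/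
theorem loopEnsemble_exists_spread_loop {n a b : ℕ} (ha : 1 ≤ a) (hb : 6 * b ≤ n) (α κ : ℝ≥0) :
    ENNReal.ofReal (1 - Real.exp (-(α * (Real.exp (-κ) / 2 *
      (Real.log (b + 1) - Real.log (a + 1)))))) ≤
    (completeNetwork n κ).loopEnsemble α
      {ω | ∃ l : DiscreteLoop (completeNetwork n κ).graph, 0 < ω l ∧
        a < 2 * l.vertices.ncard ∧ l.vertices.ncard ≤ l.1.length} := by
  classical
  set A : Finset (DiscreteLoop (completeNetwork n κ).graph) :=
    (spreadCycles n a b).subtype fun c => 2 ≤ c.length ∧ c.Chain (completeNetwork n κ).graph.Adj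
    with hA
  have hsum : ∑ l ∈ A, ((α * (completeNetwork n κ).loopMass l : ℝ≥0) : ℝ) = α *
      ∑ c ∈ spreadCycles n a b, ((cycleEdgeProd (completeNetwork n κ).trans c /
        (cycleMultiplicity c : ℝ≥0) : ℝ≥0) : ℝ) := by
    simp_rw [NNReal.coe_mul]
    rw [← Finset.mul_sum]
    congr 1
    exact Finset.sum_subtype_of_mem (fun c => ((cycleEdgeProd (completeNetwork n κ).trans c /
        (cycleMultiplicity c : ℝ≥0) : ℝ≥0) : ℝ)) fun c hc => (spreadCycles_spec ha κ hc).1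
  have hle := mul_le_mul_of_nonneg_left (le_sum_spreadCycles ha hb κ) α.coe_nonneg
  rw [← hsum] at hle
  refine (ENNReal.ofReal_le_ofReal (sub_le_sub_left
    (Real.exp_le_exp.2 (neg_le_neg hle)) 1)).trans ?_
  refine (poisson_exists_pos_ge _ A).trans (measure_mono ?_)
  rintro ω ⟨l, hl, hω⟩
  exact ⟨l, hω, (spreadCycles_spec ha κ (Finset.mem_subtype.1 hl)).2⟩

theorem tendsto_exists_spread_loop {α κ : ℝ≥0} (hα : 0 < α) {ε : ℝ} (hε₀ : 0 < ε) (hε₁ : ε < 1) :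
    Tendsto (fun n : ℕ => (completeNetwork n κ).loopEnsemble α
      {ω | ∃ l : DiscreteLoop (completeNetwork n κ).graph, 0 < ω l ∧
        (n : ℝ) ^ (1 - ε) < l.vertices.ncard ∧ l.vertices.ncard ≤ l.1.length}) atTop (𝓝 1) := by
  have hlim : Tendsto (fun n : ℕ => ENNReal.ofReal (1 - Real.exp (-(α * (Real.exp (-κ) / 2 *
      (ε * Real.log n - Real.log 24)))))) atTop (𝓝 1) := by
    rw [← ENNReal.ofReal_one]
    refine ENNReal.tendsto_ofReal ?_
    have h1 : Tendsto (fun n : ℕ => ε * Real.log n - Real.log 24) atTop atTop :=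
      tendsto_atTop_add_const_right _ _
        ((Real.tendsto_log_atTop.comp tendsto_natCast_atTop_atTop).const_mul_atTop hε₀)
    have h2 := Real.tendsto_exp_neg_atTop_nhds_zero.comp
      ((h1.const_mul_atTop (by positivity : 0 < Real.exp (-κ) / 2)).const_mul_atTop
        (NNReal.coe_pos.2 hα))
    simpa using h2.const_sub 1
  have hprob : ∀ n, IsProbabilityMeasure ((completeNetwork n κ).loopEnsemble α) := fun n => by
    unfold LoopNetwork.loopEnsemble
    infer_instance
  refine tendsto_of_tendsto_of_tendsto_of_le_of_le' hlim tendsto_const_nhds ?_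
    (Eventually.of_forall fun n => prob_le_one)
  filter_upwards [eventually_ge_atTop 1] with n hn
  have hn1 : (1 : ℝ) ≤ n := by exact_mod_cast hn
  have hpow : 1 ≤ (n : ℝ) ^ (1 - ε) := Real.one_le_rpow hn1 (by linarith)
  -- The factor 2 compensates for spread loops visiting only more than half of their length.
  set a := ⌈2 * (n : ℝ) ^ (1 - ε)⌉₊ with ha
  have ha1 : 2 * (n : ℝ) ^ (1 - ε) ≤ a := Nat.le_ceil _
  have ha2 : (a : ℝ) < 2 * (n : ℝ) ^ (1 - ε) + 1 := Nat.ceil_lt_add_one (by positivity)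
  have ha3 : 1 ≤ a := by
    have : (1 : ℝ) ≤ a := by linarith
    exact_mod_cast this
  have hb : (n : ℝ) / 6 ≤ ((n / 6 : ℕ) : ℝ) + 1 := by
    have : (n : ℝ) ≤ 6 * (((n / 6 : ℕ) : ℝ) + 1) := by
      exact_mod_cast (by omega : n ≤ 6 * (n / 6 + 1))
    linarith
  have hlogb : Real.log n - Real.log 6 ≤ Real.log (((n / 6 : ℕ) : ℝ) + 1) := by
    rw [← Real.log_div (by positivity) (by norm_num)]
    exact Real.log_le_log (by positivity) hb
  have hloga : Real.log ((a : ℝ) + 1) ≤ Real.log 4 + (1 - ε) * Real.log n := by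
    rw [← Real.log_rpow (by positivity), ← Real.log_mul (by norm_num) (by positivity)]
    exact Real.log_le_log (by positivity) (by linarith)
  -- The 4 comes from `a + 1 ≤ 4 * n ^ (1 - ε)`, using `1 ≤ n ^ (1 - ε)`; the 6 from `b = n / 6`.
  have h24 : Real.log 24 = Real.log 4 + Real.log 6 := by
    rw [← Real.log_mul (by norm_num) (by norm_num)]; norm_num
  refine le_trans (ENNReal.ofReal_le_ofReal (sub_le_sub_left (Real.exp_le_exp.2 (neg_le_neg
    (mul_le_mul_of_nonneg_left (mul_le_mul_of_nonneg_left ?_ (by positivity)) α.coe_nonneg))) 1))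
    ((loopEnsemble_exists_spread_loop ha3 (b := n / 6) (by omega) α κ).trans (measure_mono ?_))
  · linarith
  · rintro ω ⟨l, hω, h1, h2⟩
    refine ⟨l, hω, ?_, h2⟩
    have : (a : ℝ) < 2 * (l.vertices.ncard : ℝ) := by exact_mod_cast h1
    linarith

theorem mainTheorem5 (α κ : ℝ≥0) (hα : 0 < α) (hκ : 0 < κ) (ε : ℝ) (hε₀ : 0 < ε) (hε₁ : ε < 1) :
    Tendsto (fun n : ℕ => (completeNetwork n κ).loopEnsemble α
        {ω | ∃ B ∈ loopClusters ω, (n : ℝ) ^ (1 - ε) < (B.ncard : ℝ)})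
      atTop (𝓝 1) ∧
    Tendsto (fun n : ℕ => (completeNetwork n κ).loopEnsemble α
        {ω | ∃ l : DiscreteLoop (completeNetwork n κ).graph, 0 < ω l ∧
          (n : ℝ) ^ (1 - ε) < (l.1.length : ℝ) ∧
          (1 - ε) * (n : ℝ) ^ (1 - ε) < (l.vertices.ncard : ℝ)})
      atTop (𝓝 1) := by
  have hprob : ∀ n, IsProbabilityMeasure ((completeNetwork n κ).loopEnsemble α) := fun n => by
    unfold LoopNetwork.loopEnsemble
    infer_instance
  have hlim := tendsto_exists_spread_loop (κ := κ) hα hε₀ hε₁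
  constructor
  · refine tendsto_of_tendsto_of_tendsto_of_le_of_le hlim tendsto_const_nhds
      (fun n => measure_mono ?_) fun n => prob_le_one
    rintro ω ⟨l, hω, h1, -⟩
    obtain ⟨B, hB, hle⟩ := exists_cluster_of_loop hω
    exact ⟨B, hB, h1.trans_le (by exact_mod_cast hle)⟩
  · refine tendsto_of_tendsto_of_tendsto_of_le_of_le hlim tendsto_const_nhds
      (fun n => measure_mono ?_) fun n => prob_le_one
    rintro ω ⟨l, hω, h1, h2⟩
    refine ⟨l, hω, h1.trans_le (by exact_mod_cast h2), lt_of_le_of_lt ?_ h1⟩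
    exact mul_le_of_le_one_left (by positivity) (by linarith)
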